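/- All graphs are finite and simple. A graph $G$ is $5$-vertex-critical if $\chi(G)=5$ and $G-v$ is $4$-colorable for every vertex $v$ of $G$. Let $P_5$ be the path on five vertices, and let the bull be the graph obtained from a triangle by attaching one pendant vertex to each of two of its vertices. A graph is $(P_5,\text{bull})$-free if it has no induced subgraph isomorphic to $P_5$ or to the bull. Theorem. Up to isomorphism, there are only finitely many $5$-vertex-critical $(P_5,\text{bull})$-free graphs. -/

import Mathlib

namespace SimpleGraph

/-- `G` is `k`-vertex-critical: its chromatic number is `k`, and deleting any vertex leaves a
`(k - 1)`-colourable graph. For `k = 0` the graph has no vertices, so the second condition is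
void and the truncated subtraction does no harm. -/
def IsVertexCritical {V : Type*} (G : SimpleGraph V) (k : ℕ) : Prop :=
  G.chromaticNumber = k ∧ ∀ v : V, (G.induce {v}ᶜ).Colorable (k - 1)

/-- `G` is `H`-free: no induced subgraph of `G` is isomorphic to `H`. (Mathlib's
`SimpleGraph.Free` concerns subgraphs that need not be induced.) -/
def IndFree {V W : Type*} (H : SimpleGraph W) (G : SimpleGraph V) : Prop :=
  ¬ H.IsIndContained G

/-- The bull: the triangle `0, 1, 2` with two disjoint pendant edges `0 3` and `1 4`. -/
def bull : SimpleGraph (Fin 5) :=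
  fromEdgeSet {s(0, 1), s(0, 2), s(1, 2), s(0, 3), s(1, 4)}

end SimpleGraph

/-!
Freeness from `P₅` and the bull says that in a stable set the neighbourhoods of the outside
vertices are nested or disjoint. In a *prime* graph (no nontrivial homogeneous set), fix `z` and
record for each non-neighbour of `z` its *trace*, the set of common neighbours with `z`. On a
connected piece of the non-neighbours that is not complete, primality leaves exactly two traces,
one inside the other, and makes them a proper colouring. If the prime graph has a stable set of
size three, such a piece exists; a second one, around a non-neighbour of `z` with the smaller
trace, contains `z`, and together the two cover the graph, which is therefore bipartite.

A critical graph with at least two vertices has a prime quotient `H` by homogeneous sets, and `H`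
is not bipartite unless it has two vertices: a bipartite quotient would need only as many colours
as the worst pair of adjacent fibres, which survives the deletion of a vertex elsewhere. Hence `H`
has no stable set of size three, and being `k`-colourable it has at most `2k` vertices. Each fibre
is again critical, with a smaller chromatic number, because only the number of colours it uses
matters to the rest of the graph. Induction on `k` bounds the order by `2 ^ k * k!`.
-/

open SimpleGraph

section LaminarTraces

variable {V W : Type*} {G : SimpleGraph V} {H : SimpleGraph W}

/-- In every stable set of `G`, the sets of neighbours that any two vertices of `G` have there are
nested or disjoint. The condition is stated for stable triples: if `u` sees `x` and `y` but not
`z`, then a vertex seeing `y` and `z` must see `x` as well. This is the form in which freeness from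
`P₅` and the bull enters the argument. -/
def HasLaminarTraces (G : SimpleGraph V) : Prop :=
  ∀ ⦃x y z u w : V⦄, ¬G.Adj x y → ¬G.Adj y z → ¬G.Adj x z →
    G.Adj u x → G.Adj u y → ¬G.Adj u z → G.Adj w y → G.Adj w z → G.Adj w x

theorem HasLaminarTraces.of_isIndContained (hG : HasLaminarTraces G) (h : H.IsIndContained G) :
    HasLaminarTraces H := by
  obtain ⟨φ⟩ := h
  intro x y z u w
  simpa only [φ.map_adj_iff] using @hG (φ x) (φ y) (φ z) (φ u) (φ w)

theorem isIndContained_of_adj_iff {f : W → V}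
    (twinFree : ∀ i j, (∀ k, H.Adj i k ↔ H.Adj j k) → i = j)
    (hf : ∀ i j, G.Adj (f i) (f j) ↔ H.Adj i j) : H.IsIndContained G :=
  ⟨⟨⟨f, fun i j hij => twinFree i j fun k => by rw [← hf, ← hf, hij]⟩, hf _ _⟩⟩

theorem hasLaminarTraces_of_indFree (hP : (pathGraph 5).IndFree G) (hB : bull.IndFree G) :
    HasLaminarTraces G := by
  intro x y z u w hxy hyz hxz hux huy huz hwy hwz
  by_contra hwx
  by_cases huw : G.Adj u w
  · refine hB (isIndContained_of_adj_iff (f := ![u, w, y, x, z]) ?_ ?_)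
    · simp [Fin.forall_fin_succ, bull]
    · simp only [Fin.forall_fin_succ, bull]
      simp [hux, hux.symm, huy, huy.symm, hwy, hwy.symm, hwz, hwz.symm, huw, huw.symm, hxy, huz,
        hyz, hxz, hwx, G.adj_comm y x, G.adj_comm z u, G.adj_comm z y, G.adj_comm z x,
        G.adj_comm x w]
  · refine hP (isIndContained_of_adj_iff (f := ![x, u, y, w, z]) ?_ ?_)
    · simp only [pathGraph_adj]
      decide
    · simp [Fin.forall_fin_succ, pathGraph_adj, hux, hux.symm, huy, huy.symm, hwy, hwy.symm, hwz,
        hwz.symm, huw, hxy, huz, hyz, hxz, hwx, G.adj_comm y x, G.adj_comm z u, G.adj_comm z y,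
        G.adj_comm z x, G.adj_comm x w, G.adj_comm w u]

end LaminarTraces

section Connectivity

variable {V α : Type*} {G : SimpleGraph V}

theorem forall_of_preconnected (hG : G.Preconnected) {P : V → Prop}
    (step : ∀ a b, G.Adj a b → P a → P b) {a : V} (ha : P a) (b : V) : P b := by
  obtain ⟨p⟩ := hG a b
  induction p with
  | nil => exact ha
  | cons hadj _ ih => exact ih (step _ _ hadj ha)

theorem not_rainbow_triangle_of_preconnected {T : V → α} (hG : G.Preconnected)
    (hT : ∀ a b c, G.Adj a b → G.Adj b c → ¬G.Adj a c → T a = T c) {d d' : V}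
    (hdd' : ¬G.Adj d d') (hne : T d ≠ T d') {p q r : V} (hpq : G.Adj p q) (hqr : G.Adj q r)
    (hpr : G.Adj p r) (hTpq : T p ≠ T q) (hTqr : T q ≠ T r) : T p = T r := by
  by_contra hTpr
  have avoid (i j : α) : ∃ y ∈ ({p, q, r} : Set V), T y ≠ i ∧ T y ≠ j := by grind
  have triangle : G.IsClique {p, q, r} := by
    simp [isClique_insert, hpq, hqr, hpr]
  have sees : ∀ s, ∀ y ∈ ({p, q, r} : Set V), T y ≠ T s → G.Adj s y := by
    refine forall_of_preconnected hG (fun s t hst hs y hy hyt => ?_) (a := p)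
      fun y hy hyp => triangle (by simp) hy fun h => hyp (h ▸ rfl)
    obtain ⟨y₀, hy₀, hs₀, ht₀⟩ := avoid (T s) (T t)
    have hty₀ : G.Adj t y₀ := by
      by_contra h
      exact ht₀ (hT t s y₀ hst.symm (hs y₀ hy₀ hs₀) h).symm
    by_contra h
    exact hyt (hT t y₀ y hty₀ (triangle hy₀ hy fun e => h (e ▸ hty₀)) h).symm
  obtain ⟨y, hy, hyd, hyd'⟩ := avoid (T d) (T d')
  exact hne (hT d y d' (sees d y hy hyd) (sees d' y hy hyd').symm hdd')

theorem eq_or_eq_of_preconnected {T : V → α} (hG : G.Preconnected)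
    (hT : ∀ a b c, G.Adj a b → G.Adj b c → ¬G.Adj a c → T a = T c) {d d' : V}
    (hdd' : ¬G.Adj d d') (hne : T d ≠ T d') (c : V) : T c = T d ∨ T c = T d' := by
  obtain ⟨p, q, hpq, hp, hq⟩ : ∃ p q, G.Adj p q ∧ T p = T d ∧ T q ≠ T d := by
    by_contra! h
    exact hne (forall_of_preconnected hG h (a := d) rfl d').symm
  have hpqT : T p ≠ T q := fun h => hq (h ▸ hp)
  -- Having one of two values does not propagate along edges by itself; it does once some neighbour
  -- is required to carry the other value.
  have two_values : ∀ s, ∃ s', G.Adj s s' ∧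
      (T s = T p ∧ T s' = T q ∨ T s = T q ∧ T s' = T p) := by
    refine forall_of_preconnected hG (a := p) ?_ ⟨q, hpq, .inl ⟨rfl, rfl⟩⟩
    rintro s t hst ⟨s', hss', hs⟩
    have hts' (h : T t ≠ T s') : G.Adj t s' := by
      by_contra hn
      exact h (hT t s s' hst.symm hss' hn)
    have ht : T t = T s ∨ T t = T s' := by
      by_contra! h
      exact h.1 (not_rainbow_triangle_of_preconnected hG hT hdd' hne (hts' h.2) hss'.symm
        hst.symm h.2 (by grind))
    rcases hs with ⟨hs, hs'⟩ | ⟨hs, hs'⟩ <;> rcases ht with ht | ht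
    · exact ⟨s', hts' (by rw [ht, hs, hs']; exact hpqT), .inl ⟨ht.trans hs, hs'⟩⟩
    · exact ⟨s, hst.symm, .inr ⟨ht.trans hs', hs⟩⟩
    · exact ⟨s', hts' (by rw [ht, hs, hs']; exact hpqT.symm), .inr ⟨ht.trans hs, hs'⟩⟩
    · exact ⟨s, hst.symm, .inl ⟨ht.trans hs', hs⟩⟩
  have mem (s : V) : T s = T p ∨ T s = T q := by
    obtain ⟨_, _, h | h⟩ := two_values s
    exacts [.inl h.1, .inr h.1]
  have hd' : T d' = T q := (mem d').resolve_left fun h => hne (hp ▸ h.symm)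
  rw [hd', ← hp]
  exact mem c

end Connectivity

section Components

variable {V : Type*} {G : SimpleGraph V} {U C : Set V}

/-- `C` is the vertex set of a connected component of the subgraph of `G` induced on `U`. The
empty set also qualifies; it is excluded wherever a member of `C` is named. -/
structure IsComponentOn (G : SimpleGraph V) (U C : Set V) : Prop where
  subset : C ⊆ U
  preconnected : (G.induce C).Preconnected
  mem_of_adj : ∀ ⦃a b⦄, a ∈ C → b ∈ U → G.Adj a b → b ∈ C

theorem exists_isComponentOn {x : V} (hx : x ∈ U) : ∃ C, x ∈ C ∧ IsComponentOn G U C := by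
  let K := (G.induce U).connectedComponentMk ⟨x, hx⟩
  refine ⟨Subtype.val '' K.supp, ⟨⟨x, hx⟩, rfl, rfl⟩, by simp, ?_, ?_⟩
  · let φ : K.toSimpleGraph →g G.induce (Subtype.val '' K.supp) :=
      ⟨fun v => ⟨v, v, v.2, rfl⟩, id⟩
    refine K.connected_toSimpleGraph.preconnected.map φ ?_
    rintro ⟨_, v, hv, rfl⟩
    exact ⟨⟨v, hv⟩, rfl⟩
  · rintro _ b ⟨a, ha, rfl⟩ hb hab
    exact ⟨⟨b, hb⟩, K.mem_supp_of_adj_mem_supp ha hab, rfl⟩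

theorem IsComponentOn.adj_of_adj {z v a : V} (hC : IsComponentOn G (Gᶜ.neighborSet z) C)
    (ha : a ∈ C) (hva : G.Adj v a) (hv : v ∉ C) : G.Adj z v := by
  by_contra hzv
  refine hv (hC.mem_of_adj ha ⟨?_, hzv⟩ hva.symm)
  rintro rfl
  exact (hC.subset ha).2 hva

end Components

section Prime

variable {V : Type*} {G : SimpleGraph V} {M U : Set V} {a b : V}

/-- A homogeneous set, or module: no vertex outside `M` distinguishes two vertices of `M`. -/
def IsHomogeneousSet (G : SimpleGraph V) (M : Set V) : Prop :=
  ∀ ⦃v⦄, v ∉ M → ∀ ⦃a⦄, a ∈ M → ∀ ⦃b⦄, b ∈ M → G.Adj v a → G.Adj v b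

/-- A prime graph: its only homogeneous sets are the empty set, the singletons and the whole vertex
set. Graphs on at most two vertices are prime; this lets every graph with at least two vertices have
a prime quotient with at least two vertices. -/
def IsPrimeGraph (G : SimpleGraph V) : Prop :=
  ∀ ⦃M : Set V⦄, IsHomogeneousSet G M → M.Subsingleton ∨ M = Set.univ

theorem IsHomogeneousSet.of_compl (hM : IsHomogeneousSet Gᶜ M) : IsHomogeneousSet G M := by
  intro v hv a ha b hb hva
  by_contra hvb
  have hne : v ≠ b := fun h => hv (h ▸ hb)
  exact (hM hv hb ha ⟨hne, hvb⟩).2 hva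

theorem IsPrimeGraph.compl (hG : IsPrimeGraph G) : IsPrimeGraph Gᶜ :=
  fun _ hM => hG hM.of_compl

/-- Otherwise the component of `a` in the subgraph induced on `U` would be homogeneous. -/
theorem IsPrimeGraph.exists_distinguished_edge (hG : IsPrimeGraph G) (hU : U ≠ Set.univ)
    (ha : a ∈ U) (hb : b ∈ U) (hab : G.Adj a b) :
    ∃ v ∉ U, ∃ c ∈ U, ∃ c' ∈ U, G.Adj c c' ∧ G.Adj v c ∧ ¬G.Adj v c' := by
  obtain ⟨C, haC, hC⟩ := exists_isComponentOn (G := G) ha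
  by_contra! h
  have hCmod : IsHomogeneousSet G C := by
    intro v hv c hc c' hc' hvc
    have hvU : v ∉ U := fun hvU => hv (hC.mem_of_adj hc hvU hvc.symm)
    exact forall_of_preconnected hC.preconnected (P := fun x => G.Adj v x.1) (a := ⟨c, hc⟩)
      (fun x y hxy => h v hvU x (hC.subset x.2) y (hC.subset y.2) hxy) hvc ⟨c', hc'⟩
  rcases hG hCmod with hsub | huniv
  · exact hab.ne (hsub haC (hC.mem_of_adj haC hb hab))
  · exact hU (Set.univ_subset_iff.1 (huniv ▸ hC.subset))

theorem IsPrimeGraph.exists_distinguished_nonedge (hG : IsPrimeGraph G) (hU : U ≠ Set.univ)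
    (ha : a ∈ U) (hb : b ∈ U) (hne : a ≠ b) (hab : ¬G.Adj a b) :
    ∃ v ∉ U, ∃ c ∈ U, ∃ c' ∈ U, c ≠ c' ∧ ¬G.Adj c c' ∧ G.Adj v c ∧ ¬G.Adj v c' := by
  obtain ⟨v, hv, c, hc, c', hc', hcc', hvc, hvc'⟩ :=
    hG.compl.exists_distinguished_edge hU ha hb ⟨hne, hab⟩
  have hvne : v ≠ c' := fun h => hv (h ▸ hc')
  refine ⟨v, hv, c', hc', c, hc, hcc'.1.symm, fun h => hcc'.2 h.symm, ?_, hvc.2⟩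
  by_contra h
  exact hvc' ⟨hvne, h⟩

end Prime

section TwoLevel

variable {V : Type*} {G : SimpleGraph V} {z z' a b c : V} {C C' : Set V}

theorem HasLaminarTraces.commonNeighbors_subset (hG : HasLaminarTraces G) (hza : ¬G.Adj z a)
    (hzb : ¬G.Adj z b) (hzc : ¬G.Adj z c) (hab : G.Adj a b) (hbc : G.Adj b c)
    (hac : ¬G.Adj a c) : G.commonNeighbors z a ⊆ G.commonNeighbors z c :=
  fun _ hu => ⟨hu.1, (hG (fun h => hac h.symm) (fun h => hza h.symm) (fun h => hzc h.symm)
    hbc hab.symm (fun h => hzb h.symm) hu.2.symm hu.1.symm).symm⟩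

theorem HasLaminarTraces.commonNeighbors_eq (hG : HasLaminarTraces G) (hza : ¬G.Adj z a)
    (hzb : ¬G.Adj z b) (hzc : ¬G.Adj z c) (hab : G.Adj a b) (hbc : G.Adj b c)
    (hac : ¬G.Adj a c) : G.commonNeighbors z a = G.commonNeighbors z c :=
  (hG.commonNeighbors_subset hza hzb hzc hab hbc hac).antisymm
    (hG.commonNeighbors_subset hzc hzb hza hbc.symm hab.symm fun h => hac h.symm)

theorem HasLaminarTraces.commonNeighbors_subset_or_subset (hG : HasLaminarTraces G)
    (hza : ¬G.Adj z a) (hzc : ¬G.Adj z c) (hac : ¬G.Adj a c) :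
    G.commonNeighbors z a ⊆ G.commonNeighbors z c ∨
      G.commonNeighbors z c ⊆ G.commonNeighbors z a := by
  by_contra! h
  obtain ⟨u, hu, hu'⟩ := Set.not_subset.1 h.1
  obtain ⟨w, hw, hw'⟩ := Set.not_subset.1 h.2
  exact hw' ⟨hw.1, (hG (fun h => hza h.symm) hzc hac hu.2.symm hu.1.symm
    (fun h => hu' ⟨hu.1, h.symm⟩) hw.1.symm hw.2.symm).symm⟩

/-- On the component `C` of the non-neighbours of `z`, the map sending `c` to its trace
`G.commonNeighbors z c` has exactly two values, the larger one attained at `hi` and the smaller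
one at `lo`, and it is a proper colouring of `C`. Two such components cover a prime graph with a
stable set of size three, and its bipartition is read off from their traces. -/
structure IsTwoLevel (G : SimpleGraph V) (z : V) (C : Set V) (hi lo : V) : Prop where
  isComponentOn : IsComponentOn G (Gᶜ.neighborSet z) C
  mem_hi : hi ∈ C
  mem_lo : lo ∈ C
  not_adj : ¬G.Adj hi lo
  ssubset : G.commonNeighbors z lo ⊂ G.commonNeighbors z hi
  eq_or_eq : ∀ c ∈ C, G.commonNeighbors z c = G.commonNeighbors z hi ∨
    G.commonNeighbors z c = G.commonNeighbors z lo
  ne_of_adj : ∀ ⦃a⦄, a ∈ C → ∀ ⦃b⦄, b ∈ C → G.Adj a b →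
    G.commonNeighbors z a ≠ G.commonNeighbors z b

/-- If `U` consists of the vertices of `C` with one fixed trace on `z`, then no vertex outside `U`
distinguishes the ends of an edge inside `U`. -/
theorem IsPrimeGraph.commonNeighbors_ne_of_adj (hp : IsPrimeGraph G) (hG : HasLaminarTraces G)
    (hC : IsComponentOn G (Gᶜ.neighborSet z) C) (ha : a ∈ C) (hb : b ∈ C) (hab : G.Adj a b) :
    G.commonNeighbors z a ≠ G.commonNeighbors z b := by
  intro heq
  let U : Set V := {x ∈ C | G.commonNeighbors z x = G.commonNeighbors z a}
  have hU : U ≠ Set.univ := fun h => (hC.subset (h ▸ Set.mem_univ z : z ∈ U).1).1 rfl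
  obtain ⟨v, hv, e, ⟨he, heT⟩, e', ⟨he', heT'⟩, hee', hve, hve'⟩ :=
    hp.exists_distinguished_edge hU (a := a) (b := b) ⟨ha, rfl⟩ ⟨hb, heq.symm⟩ hab
  by_cases hvC : v ∈ C
  · have hvT : G.commonNeighbors z v = G.commonNeighbors z e' := hG.commonNeighbors_eq
      (hC.subset hvC).2 (hC.subset he).2 (hC.subset he').2 hve hee' hve'
    exact hv ⟨hvC, hvT.trans heT'⟩
  · have hve : v ∈ G.commonNeighbors z e := ⟨hC.adj_of_adj he hve hvC, hve.symm⟩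
    rw [heT, ← heT'] at hve
    exact hve' hve.2.symm

theorem IsPrimeGraph.exists_isTwoLevel (hp : IsPrimeGraph G) (hG : HasLaminarTraces G)
    (ha : a ∈ Gᶜ.neighborSet z) (hb : b ∈ Gᶜ.neighborSet z) (hc : c ∈ Gᶜ.neighborSet z)
    (hab : G.Adj a b) (hbc : G.Adj b c) (hac : ¬G.Adj a c) (hne : a ≠ c) :
    ∃ C hi lo, b ∈ C ∧ IsTwoLevel G z C hi lo := by
  obtain ⟨C, hbC, hC⟩ := exists_isComponentOn (G := G) hb
  have hCuniv : C ≠ Set.univ := fun h => (hC.subset (h ▸ Set.mem_univ z)).1 rfl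
  obtain ⟨v, hv, hi, hhi, lo, hlo, -, hadj, hvhi, hvlo⟩ := hp.exists_distinguished_nonedge hCuniv
    (hC.mem_of_adj hbC ha hab.symm) (hC.mem_of_adj hbC hc hbc) hne hac
  have hzv : G.Adj z v := hC.adj_of_adj hhi hvhi hv
  have hnsub : ¬G.commonNeighbors z hi ⊆ G.commonNeighbors z lo :=
    fun h => hvlo (h ⟨hzv, hvhi.symm⟩).2.symm
  have hsub : G.commonNeighbors z lo ⊆ G.commonNeighbors z hi :=
    (hG.commonNeighbors_subset_or_subset (hC.subset hhi).2 (hC.subset hlo).2 hadj).resolve_left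
      hnsub
  have hT (x y w : C) (hxy : G.Adj x y) (hyw : G.Adj y w) (hxw : ¬G.Adj x w) :
      G.commonNeighbors z x = G.commonNeighbors z w := hG.commonNeighbors_eq
    (hC.subset x.2).2 (hC.subset y.2).2 (hC.subset w.2).2 hxy hyw hxw
  exact ⟨C, hi, lo, hbC, hC, hhi, hlo, hadj, ⟨hsub, hnsub⟩,
    fun x hx => eq_or_eq_of_preconnected hC.preconnected (T := fun x : C => G.commonNeighbors z x)
      hT (d := ⟨hi, hhi⟩) (d' := ⟨lo, hlo⟩) hadj (fun h => hnsub h.subset) ⟨x, hx⟩,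
    fun x hx y hy => hp.commonNeighbors_ne_of_adj hG hC hx hy⟩

namespace IsTwoLevel

variable {hi lo : V}

theorem commonNeighbors_lo_subset (h : IsTwoLevel G z C hi lo) (hc : c ∈ C) :
    G.commonNeighbors z lo ⊆ G.commonNeighbors z c := by
  rcases h.eq_or_eq c hc with hc | hc <;> rw [hc]
  exact h.ssubset.subset

theorem eq_lo_iff_of_adj (h : IsTwoLevel G z C hi lo) (ha : a ∈ C) (hb : b ∈ C)
    (hab : G.Adj a b) : G.commonNeighbors z a = G.commonNeighbors z lo ↔
      G.commonNeighbors z b ≠ G.commonNeighbors z lo := by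
  have hne := h.ne_of_adj ha hb hab
  refine ⟨fun ha hb => hne (ha.trans hb.symm), fun hb' => ?_⟩
  by_contra ha'
  exact hne (((h.eq_or_eq a ha).resolve_right ha').trans
    ((h.eq_or_eq b hb).resolve_right hb').symm)

theorem hi_ne_lo (h : IsTwoLevel G z C hi lo) : hi ≠ lo := by
  rintro rfl
  exact h.ssubset.ne rfl

theorem exists_adj_lo (h : IsTwoLevel G z C hi lo) : ∃ e ∈ C, G.Adj lo e := by
  by_contra! hlo
  have : (⟨hi, h.mem_hi⟩ : C) = ⟨lo, h.mem_lo⟩ :=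
    forall_of_preconnected h.isComponentOn.preconnected (P := (· = ⟨lo, h.mem_lo⟩))
      (by rintro _ x hx rfl; exact absurd hx (hlo x x.2)) rfl _
  exact h.hi_ne_lo (congrArg Subtype.val this)

theorem exists_opposite (h : IsTwoLevel G z C hi lo) (hp : IsPrimeGraph G)
    (hG : HasLaminarTraces G) : ∃ C' hi' lo', IsTwoLevel G lo C' hi' lo' ∧ z ∈ C' ∧
      G.commonNeighbors lo z = G.commonNeighbors lo lo' := by
  have hC := h.isComponentOn
  obtain ⟨hne, hzlo⟩ := hC.subset h.mem_lo
  obtain ⟨-, hzhi⟩ := hC.subset h.mem_hi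
  obtain ⟨b, hb, hb'⟩ := Set.exists_of_ssubset h.ssubset
  have hz : z ∈ Gᶜ.neighborSet lo := ⟨hne.symm, fun hadj => hzlo hadj.symm⟩
  obtain ⟨C', hi', lo', hbC', h'⟩ := hp.exists_isTwoLevel hG (c := hi) hz
    ⟨fun hlob => hzlo (hlob ▸ hb.1), fun hlob => hb' ⟨hb.1, hlob⟩⟩
    ⟨h.hi_ne_lo.symm, fun hadj => h.not_adj hadj.symm⟩ hb.1 hb.2.symm hzhi
    (hC.subset h.mem_hi).1
  have hzC' : z ∈ C' := h'.isComponentOn.mem_of_adj hbC' hz hb.1.symm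
  refine ⟨C', hi', lo', h', hzC', ?_⟩
  by_contra hzT
  have hbT : G.commonNeighbors lo b = G.commonNeighbors lo lo' :=
    (h'.eq_lo_iff_of_adj hbC' hzC' hb.1.symm).2 hzT
  obtain ⟨e, heC, hloe⟩ := h.exists_adj_lo
  have heT : G.commonNeighbors z e = G.commonNeighbors z hi := (h.eq_or_eq e heC).resolve_right
    (h.ne_of_adj heC h.mem_lo hloe.symm)
  have he : e ∈ G.commonNeighbors lo b := ⟨hloe, (heT ▸ hb : b ∈ G.commonNeighbors z e).2.symm⟩
  exact (hC.subset heC).2 (h'.commonNeighbors_lo_subset hzC' (hbT ▸ he)).2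

end IsTwoLevel

theorem IsPrimeGraph.union_eq_univ (hp : IsPrimeGraph G)
    (hC : IsComponentOn G (Gᶜ.neighborSet z) C) (hC' : IsComponentOn G (Gᶜ.neighborSet z') C')
    (hz' : z' ∈ C) (hz : z ∈ C') (h : ∀ c ∈ C, G.commonNeighbors z z' ⊆ G.commonNeighbors z c)
    (h' : ∀ c ∈ C', G.commonNeighbors z' z ⊆ G.commonNeighbors z' c) : C ∪ C' = Set.univ := by
  have hmod : IsHomogeneousSet G (C ∪ C') := by
    intro v hv a ha b hb hva
    obtain ⟨hvC, hvC'⟩ := not_or.1 hv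
    obtain ⟨hzv, hzv'⟩ : G.Adj z v ∧ G.Adj z' v := by
      rcases ha with ha | ha
      · have hzv := hC.adj_of_adj ha hva hvC
        exact ⟨hzv, hC'.adj_of_adj hz hzv.symm hvC'⟩
      · have hzv' := hC'.adj_of_adj ha hva hvC'
        exact ⟨hC.adj_of_adj hz' hzv'.symm hvC, hzv'⟩
    rcases hb with hb | hb
    · exact (h b hb ⟨hzv, hzv'⟩).2.symm
    · exact (h' b hb ⟨hzv', hzv⟩).2.symm
  exact (hp hmod).resolve_left fun hsub => (hC.subset hz').1 (hsub (.inr hz) (.inl hz'))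

theorem commonNeighbors_eq_empty_of_union_eq_univ (hU : C ∪ C' = Set.univ)
    (h : ∀ c ∈ C, G.commonNeighbors z z' ⊆ G.commonNeighbors z c)
    (h' : ∀ c ∈ C', G.commonNeighbors z' z ⊆ G.commonNeighbors z' c) :
    G.commonNeighbors z z' = ∅ := by
  refine Set.eq_empty_of_forall_notMem fun x hx => ?_
  rcases hU ▸ Set.mem_univ x with hxC | hxC
  · exact G.irrefl (h x hxC hx).2
  · exact G.irrefl (h' x hxC hx.symm).2

theorem IsTwoLevel.colorable_two_of_union_eq_univ {hi lo hi' lo' : V}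
    (h : IsTwoLevel G z C hi lo) (h' : IsTwoLevel G lo C' hi' lo') (hz : z ∈ C')
    (hU : C ∪ C' = Set.univ) (hlo : G.commonNeighbors z lo = ∅)
    (hlo' : G.commonNeighbors lo lo' = ∅) : G.Colorable 2 := by
  have hC' {x} (hx : x ∉ C) : x ∈ C' := (hU ▸ Set.mem_univ x : x ∈ C ∪ C').resolve_left hx
  have inside {a b} (ha : a ∈ C) (hb : b ∈ C) (hab : G.Adj a b) :
      G.commonNeighbors z a = ∅ ↔ G.commonNeighbors z b ≠ ∅ :=
    hlo ▸ h.eq_lo_iff_of_adj ha hb hab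
  have outside {a b} (ha : a ∈ C') (hb : b ∈ C') (hab : G.Adj a b) :
      G.commonNeighbors lo a = ∅ ↔ G.commonNeighbors lo b ≠ ∅ :=
    hlo' ▸ h'.eq_lo_iff_of_adj ha hb hab
  have across {a b} (ha : a ∈ C) (hb : b ∉ C) (hab : G.Adj a b) :
      G.commonNeighbors z a ≠ ∅ ∧ G.commonNeighbors lo b ≠ ∅ := by
    have hzb := h.isComponentOn.adj_of_adj ha hab.symm hb
    exact ⟨Set.nonempty_iff_ne_empty.1 ⟨b, hzb, hab⟩,
      (outside hz (hC' hb) hzb).1 (by rw [commonNeighbors_symm, hlo])⟩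
  classical
  let color (v : V) : Prop :=
    if v ∈ C then G.commonNeighbors z v = ∅ else G.commonNeighbors lo v ≠ ∅
  refine (Coloring.mk color fun {a b} hab => ?_ : G.Coloring Prop).colorable
  by_cases ha : a ∈ C <;> by_cases hb : b ∈ C <;>
    simp only [color, ha, hb, if_true, if_false, ne_eq, eq_iff_iff]
  · simp only [inside ha hb hab, ne_eq, not_iff_self, not_false_iff]
  · simp only [across ha hb hab, not_false_iff, iff_true]
  · simp only [across hb ha hab.symm, not_false_iff, true_iff]
  · simp only [outside (hC' ha) (hC' hb) hab, ne_eq, not_not, iff_not_self, not_false_iff]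

theorem IsTwoLevel.colorable_two {hi lo : V} (h : IsTwoLevel G z C hi lo) (hp : IsPrimeGraph G)
    (hG : HasLaminarTraces G) : G.Colorable 2 := by
  obtain ⟨C', hi', lo', h', hz, hzT⟩ := h.exists_opposite hp hG
  have hsub (c) (hc : c ∈ C) := h.commonNeighbors_lo_subset hc
  have hsub' (c) (hc : c ∈ C') : G.commonNeighbors lo z ⊆ G.commonNeighbors lo c :=
    hzT ▸ h'.commonNeighbors_lo_subset hc
  have hU := hp.union_eq_univ h.isComponentOn h'.isComponentOn h.mem_lo hz hsub hsub'
  have hlo := commonNeighbors_eq_empty_of_union_eq_univ hU hsub hsub'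
  exact h.colorable_two_of_union_eq_univ h' hz hU hlo (by rw [← hzT, commonNeighbors_symm, hlo])

theorem IsPrimeGraph.colorable_two (hp : IsPrimeGraph G) (hG : HasLaminarTraces G)
    (h : ¬G.IndepSetFree 3) : G.Colorable 2 := by
  obtain ⟨x, y, t, hxy, hxt, hyt⟩ : ∃ x y t, Gᶜ.Adj x y ∧ Gᶜ.Adj x t ∧ Gᶜ.Adj y t := by
    rw [← cliqueFree_compl, CliqueFree] at h
    push Not at h
    obtain ⟨s, hs⟩ := h
    classical
    obtain ⟨x, y, t, hxy, hxt, hyt, -⟩ := is3Clique_iff.1 hs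
    exact ⟨x, y, t, hxy, hxt, hyt⟩
  have hU : Gᶜ.neighborSet x ≠ Set.univ := fun h =>
    (h ▸ Set.mem_univ x : x ∈ Gᶜ.neighborSet x).1 rfl
  obtain ⟨v, hv, c, hc, z, hz, hcz, hadj, hvc, hvz⟩ :=
    hp.exists_distinguished_nonedge hU hxy hxt hyt.1 hyt.2
  have hxv : G.Adj x v := by
    by_contra hxv
    refine hv ⟨?_, hxv⟩
    rintro rfl
    exact hc.2 hvc
  obtain ⟨C, hi, lo, -, h⟩ := hp.exists_isTwoLevel hG (z := z) (a := x) (b := v) (c := c)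
    ⟨hz.1.symm, fun h => hz.2 h.symm⟩ ⟨fun h => hz.2 (h ▸ hxv), fun h => hvz h.symm⟩
    ⟨hcz.symm, fun h => hadj h.symm⟩ hxv hvc hc.2 hc.1
  exact h.colorable_two hp hG

end TwoLevel

section ModularQuotient

universe u

variable {V W X : Type*} {G : SimpleGraph V} {H : SimpleGraph W} {K : SimpleGraph X} {f : V → W}

/-- `f` exhibits `H` as the quotient of `G` by a partition into homogeneous sets, namely the fibres
of `f`. Inside a fibre, the edges of `G` are unrestricted. -/
structure IsModularQuotientMap (G : SimpleGraph V) (H : SimpleGraph W) (f : V → W) : Prop where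
  surjective : Function.Surjective f
  adj_iff : ∀ ⦃v w⦄, f v ≠ f w → (G.Adj v w ↔ H.Adj (f v) (f w))

namespace IsModularQuotientMap

theorem id : IsModularQuotientMap G G id :=
  ⟨Function.surjective_id, fun _ _ _ => Iff.rfl⟩

theorem comp {g : W → X} (hg : IsModularQuotientMap H K g) (hf : IsModularQuotientMap G H f) :
    IsModularQuotientMap G K (g ∘ f) :=
  ⟨hg.surjective.comp hf.surjective, fun _ _ hne =>
    (hf.adj_iff fun h => hne (congrArg g h)).trans (hg.adj_iff hne)⟩

theorem isIndContained (hf : IsModularQuotientMap G H f) : H.IsIndContained G := by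
  obtain ⟨g, hg⟩ := hf.surjective.hasRightInverse
  refine ⟨⟨⟨g, hg.injective⟩, fun {r s} => ?_⟩⟩
  rcases eq_or_ne r s with rfl | hne
  · simp only [SimpleGraph.irrefl]
  · have h := hf.adj_iff (v := g r) (w := g s) (by rwa [hg, hg])
    rwa [hg, hg] at h

theorem isHomogeneousSet_fiber (hf : IsModularQuotientMap G H f) (r : W) :
    IsHomogeneousSet G (f ⁻¹' {r}) := by
  rintro v hv a rfl b hb hva
  rw [hf.adj_iff hv] at hva
  rw [Set.mem_preimage, Set.mem_singleton_iff] at hb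
  rwa [hf.adj_iff (hb ▸ hv), hb]

theorem fiber_ne_univ [Nontrivial W] (hf : IsModularQuotientMap G H f) (r : W) :
    f ⁻¹' {r} ≠ Set.univ := by
  obtain ⟨s, hs⟩ := exists_ne r
  obtain ⟨v, rfl⟩ := hf.surjective s
  exact fun h => hs (h ▸ Set.mem_univ v : v ∈ f ⁻¹' {r})

end IsModularQuotientMap

theorem IsHomogeneousSet.exists_isModularQuotientMap {M : Set V} {a : V}
    (hM : IsHomogeneousSet G M) (ha : a ∈ M) :
    ∃ f, IsModularQuotientMap G (G.induce (insert a Mᶜ)) f := by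
  classical
  let f (v : V) : (insert a Mᶜ : Set V) := if hv : v ∈ M then ⟨a, .inl rfl⟩ else ⟨v, .inr hv⟩
  have f_mem {v} (hv : v ∈ M) : f v = ⟨a, .inl rfl⟩ := dif_pos hv
  have f_notMem {v} (hv : v ∉ M) : f v = ⟨v, .inr hv⟩ := dif_neg hv
  have adj_iff {v w} (hv : v ∈ M) (hw : w ∉ M) : G.Adj w v ↔ G.Adj w a :=
    ⟨@hM w hw v hv a ha, @hM w hw a ha v hv⟩
  refine ⟨f, ?_, fun v w hne => ?_⟩
  · rintro ⟨v, rfl | hv⟩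
    exacts [⟨v, f_mem ha⟩, ⟨v, f_notMem hv⟩]
  · by_cases hv : v ∈ M <;> by_cases hw : w ∈ M
    · exact absurd ((f_mem hv).trans (f_mem hw).symm) hne
    · rw [f_mem hv, f_notMem hw, comap_adj, G.adj_comm v, adj_iff hv hw, G.adj_comm w]
      rfl
    · rw [f_notMem hv, f_mem hw, adj_iff hw hv]
      rfl
    · rw [f_notMem hv, f_notMem hw]
      rfl

theorem exists_isPrimeGraph_quotient {V : Type u} [Finite V] [Nontrivial V] (G : SimpleGraph V) :
    ∃ (W : Type u) (H : SimpleGraph W) (f : V → W),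
      Nontrivial W ∧ IsPrimeGraph H ∧ IsModularQuotientMap G H f := by
  induction hn : Nat.card V using Nat.strong_induction_on generalizing V with
  | _ n ih =>
    subst hn
    by_cases hG : IsPrimeGraph G
    · exact ⟨V, G, id, inferInstance, hG, .id⟩
    obtain ⟨M, hM, hMsub, hMuniv⟩ :
        ∃ M, IsHomogeneousSet G M ∧ ¬M.Subsingleton ∧ M ≠ Set.univ := by
      simpa only [IsPrimeGraph, not_forall, not_or, exists_prop] using hG
    obtain ⟨a, ha, b, hb, hab⟩ := Set.not_subsingleton_iff.1 hMsub
    obtain ⟨c, hc⟩ := (Set.ne_univ_iff_exists_notMem M).1 hMuniv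
    obtain ⟨f, hf⟩ := hM.exists_isModularQuotientMap ha
    have : Nontrivial (insert a Mᶜ : Set V) :=
      Set.nontrivial_coe_sort.2 ⟨a, .inl rfl, c, .inr hc, fun h => hc (h ▸ ha)⟩
    have hlt : Nat.card (insert a Mᶜ : Set V) < Nat.card V :=
      Finite.card_subtype_lt (x := b) fun h => h.elim hab.symm (· hb)
    obtain ⟨W, H, g, hW, hH, hg⟩ := ih _ hlt (G.induce (insert a Mᶜ)) rfl
    exact ⟨W, H, g ∘ f, hW, hH, hg.comp hf⟩

end ModularQuotient

section Critical

universe u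

variable {V W α : Type*} {G : SimpleGraph V} {H : SimpleGraph W} {f : V → W} {M A B : Set V}
  {k n : ℕ}

theorem colorable_of_isVertexCritical (hG : G.IsVertexCritical k) : G.Colorable k :=
  chromaticNumber_le_iff_colorable.1 hG.1.le

theorem pos_of_isVertexCritical [Nonempty V] (hG : G.IsVertexCritical k) : 0 < k :=
  Nat.pos_of_ne_zero fun h =>
    not_isEmpty_of_nonempty V (h ▸ colorable_of_isVertexCritical hG).isEmpty

theorem not_colorable_of_isVertexCritical [Nonempty V] (hG : G.IsVertexCritical k) :
    ¬G.Colorable (k - 1) := by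
  intro h
  have hk := pos_of_isVertexCritical hG
  have : k ≤ k - 1 := by
    exact_mod_cast hG.1 ▸ chromaticNumber_le_iff_colorable.2 h
  omega

theorem colorable_induce_of_isVertexCritical (hG : G.IsVertexCritical k) {v : V} (hv : v ∉ A) :
    (G.induce A).Colorable (k - 1) :=
  (hG.2 v).of_hom (induceHomOfLE G fun _ hx hxv => hv ((hxv : _ = v) ▸ hx)).toHom

/-- The colours which `c` uses on `M` occur at no vertex outside `M` with a neighbour in `M`. -/
theorem IsHomogeneousSet.nonempty_coloring {v : V} (hM : IsHomogeneousSet G M) (hv : v ∈ M)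
    (c : (G.induce {v}ᶜ).Coloring α) (g : (G.induce M).Coloring (c '' {x | x.1 ∈ M})) :
    Nonempty (G.Coloring α) := by
  classical
  have ne_of_mem {x} (hx : x ∉ M) : x ∈ ({v}ᶜ : Set V) := fun h => hx (h ▸ hv)
  have cross {x y} (hx : x ∉ M) (hy : y ∈ M) (hxy : G.Adj x y) :
      c ⟨x, ne_of_mem hx⟩ ≠ g ⟨y, hy⟩ := by
    obtain ⟨m, hm, hmg⟩ := (g ⟨y, hy⟩).2
    rw [← hmg]
    exact c.valid (hM hx hy hm hxy)
  refine ⟨Coloring.mk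
    (fun x => if hx : x ∈ M then (g ⟨x, hx⟩ : α) else c ⟨x, ne_of_mem hx⟩) fun {x y} hxy => ?_⟩
  by_cases hx : x ∈ M <;> by_cases hy : y ∈ M <;> simp only [hx, hy, dite_true, dite_false]
  · exact fun h => g.valid (v := ⟨x, hx⟩) (w := ⟨y, hy⟩) hxy (Subtype.ext h)
  · exact (cross hy hx hxy.symm).symm
  · exact cross hx hy hxy
  · exact c.valid hxy

theorem colorable_induce_ncard_image [Finite α] (c : G.Coloring α) (S : Set V) :
    (G.induce S).Colorable (c '' S).ncard := by
  have := Fintype.ofFinite (c '' S)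
  let c' : (G.induce S).Coloring (c '' S) :=
    Coloring.mk (fun x => ⟨c x, x, x.2, rfl⟩) fun hxy h => c.valid hxy (Subtype.ext_iff.1 h)
  rw [← Nat.card_coe_set_eq, Nat.card_eq_fintype_card]
  exact c'.colorable

theorem IsHomogeneousSet.exists_isVertexCritical_induce (hM : IsHomogeneousSet G M)
    (hG : G.IsVertexCritical k) (huniv : M ≠ Set.univ) :
    ∃ j < k, (G.induce M).IsVertexCritical j := by
  obtain ⟨w, hw⟩ := (Set.ne_univ_iff_exists_notMem M).1 huniv
  have : Nonempty V := ⟨w⟩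
  have hk := pos_of_isVertexCritical hG
  have hcol := colorable_induce_of_isVertexCritical hG hw
  obtain ⟨j, hj⟩ := ENat.ne_top_iff_exists.1 (chromaticNumber_ne_top_iff_exists.2 ⟨_, hcol⟩)
  have hjk : j ≤ k - 1 := by exact_mod_cast hj ▸ chromaticNumber_le_iff_colorable.2 hcol
  have hjcol : (G.induce M).Colorable j := chromaticNumber_le_iff_colorable.1 hj.ge
  refine ⟨j, by omega, hj.symm, fun v => ?_⟩
  obtain ⟨c⟩ := hG.2 v
  let S : Set ({v.1}ᶜ : Set V) := {x | x.1 ∈ M}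
  have hlt : (c '' S).ncard < j := by
    by_contra! hle
    have := Fintype.ofFinite (c '' S)
    rw [← Nat.card_coe_set_eq, Nat.card_eq_fintype_card] at hle
    exact not_colorable_of_isVertexCritical hG
      (hM.nonempty_coloring v.2 c (hjcol.toColoring hle))
  let φ : (G.induce M).induce {v}ᶜ →g (G.induce {v.1}ᶜ).induce S :=
    ⟨fun x => ⟨⟨x.1, fun h => x.2 (Subtype.ext h)⟩, x.1.2⟩, id⟩
  exact ((colorable_induce_ncard_image c S).of_hom φ).mono (by omega)

theorem exists_add_le_of_complete (h : (G.induce (A ∪ B)).Colorable n)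
    (hAB : ∀ a ∈ A, ∀ b ∈ B, G.Adj a b) :
    ∃ p q, p + q ≤ n ∧ (G.induce A).Colorable p ∧ (G.induce B).Colorable q := by
  obtain ⟨c⟩ := h
  let A' : Set (A ∪ B : Set V) := Subtype.val ⁻¹' A
  let B' : Set (A ∪ B : Set V) := Subtype.val ⁻¹' B
  let φ : G.induce A →g (G.induce (A ∪ B)).induce A' := ⟨fun a => ⟨⟨a, .inl a.2⟩, a.2⟩, id⟩
  let ψ : G.induce B →g (G.induce (A ∪ B)).induce B' := ⟨fun b => ⟨⟨b, .inr b.2⟩, b.2⟩, id⟩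
  refine ⟨_, _, ?_, (colorable_induce_ncard_image c A').of_hom φ,
    (colorable_induce_ncard_image c B').of_hom ψ⟩
  have hdisj : Disjoint (c '' A') (c '' B') := by
    rw [Set.disjoint_left]
    rintro _ ⟨a, ha, rfl⟩ ⟨b, hb, hab⟩
    exact c.valid (v := a) (w := b) (hAB a ha b hb) hab.symm
  rw [← Set.ncard_union_eq hdisj]
  exact (Set.ncard_le_card _).trans_eq (Nat.card_fin n)

/-- The fibres on one side of the bipartition of `H` use the colours from below, those on the
other side from above. -/
theorem IsModularQuotientMap.colorable_of_colorable_two (hf : IsModularQuotientMap G H f)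
    (hH : H.Colorable 2) {m : W → ℕ} (hm : ∀ r, (G.induce (f ⁻¹' {r})).Colorable (m r))
    (hle : ∀ r, m r ≤ n) (hadd : ∀ r s, H.Adj r s → m r + m s ≤ n) : G.Colorable n := by
  let side : H.Coloring Bool := hH.toColoring (by simp)
  let g (r : W) : (G.induce (f ⁻¹' {r})).Coloring (Fin (m r)) := (hm r).some
  let color (r : W) (x : f ⁻¹' {r}) : Fin n :=
    if side r then Fin.castLE (hle r) (g r x) else (Fin.castLE (hle r) (g r x)).rev
  refine ⟨Coloring.mk (fun v => color (f v) ⟨v, rfl⟩) fun {v w} hvw => ?_⟩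
  rcases eq_or_ne (f v) (f w) with hfvw | hfvw
  · have same_fiber (r) (x y : f ⁻¹' {r}) (hxy : G.Adj x y) : color r x ≠ color r y := by
      have := (g r).valid (v := x) (w := y) hxy
      simp only [color]
      split <;> simpa using this
    have transport (r) (hr : f w = r) : color (f w) ⟨w, rfl⟩ = color r ⟨w, hr⟩ := by
      subst hr
      rfl
    rw [transport _ hfvw.symm]
    exact same_fiber _ _ _ hvw
  · have hadj := (hf.adj_iff hfvw).1 hvw
    have hside := side.valid hadj
    have hsum := hadd _ _ hadj
    have hltv := (g (f v) ⟨v, rfl⟩).2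
    have hltw := (g (f w) ⟨w, rfl⟩).2
    cases hv : side (f v) <;> cases hw : side (f w)
    · exact absurd (hv.trans hw.symm) hside
    · simp only [color, hv, hw, Bool.false_eq_true, if_true, if_false, ne_eq, Fin.ext_iff,
        Fin.val_rev, Fin.val_castLE]
      omega
    · simp only [color, hv, hw, Bool.false_eq_true, if_true, if_false, ne_eq, Fin.ext_iff,
        Fin.val_rev, Fin.val_castLE]
      omega
    · exact absurd (hv.trans hw.symm) hside

/-- An edge of `H` leaves out some fibre, so deleting a vertex of that fibre bounds the sum of the
chromatic numbers of the two fibres at the ends of the edge. -/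
theorem IsModularQuotientMap.not_colorable_two (hf : IsModularQuotientMap G H f)
    (hG : G.IsVertexCritical k) (hW : 3 ≤ ENat.card W) : ¬H.Colorable 2 := by
  intro hH
  have hmin (r) : ∃ m, (G.induce (f ⁻¹' {r})).Colorable m ∧
      ∀ p, (G.induce (f ⁻¹' {r})).Colorable p → m ≤ p := by
    classical
    have hcol : ∃ m, (G.induce (f ⁻¹' {r})).Colorable m :=
      ⟨k, (colorable_of_isVertexCritical hG).of_hom (Embedding.induce _).toHom⟩
    exact ⟨Nat.find hcol, Nat.find_spec hcol, fun _ => Nat.find_min' hcol⟩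
  choose m hm hmle using hmin
  have hpair (r s) : ∃ v, f v ≠ r ∧ f v ≠ s := by
    obtain ⟨t, htr, hts⟩ := ENat.exists_ne_ne_of_three_le hW r s
    obtain ⟨v, rfl⟩ := hf.surjective t
    exact ⟨v, htr, hts⟩
  have : Nonempty W := (ENat.card_pos_iff_nonempty W).1 (lt_of_lt_of_le (by norm_num) hW)
  have : Nonempty V := hf.surjective.nonempty
  refine not_colorable_of_isVertexCritical hG (hf.colorable_of_colorable_two hH hm ?_ ?_)
  · intro r
    obtain ⟨v, hv, -⟩ := hpair r r
    exact hmle r _ (colorable_induce_of_isVertexCritical hG hv)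
  · intro r s hrs
    obtain ⟨v, hvr, hvs⟩ := hpair r s
    have hv : v ∉ f ⁻¹' {r} ∪ f ⁻¹' {s} := fun h => h.elim hvr hvs
    obtain ⟨p, q, hpq, hp, hq⟩ := exists_add_le_of_complete
      (colorable_induce_of_isVertexCritical hG hv) (by
        rintro a rfl b rfl
        exact (hf.adj_iff hrs.ne).2 hrs)
    exact (add_le_add (hmle r p hp) (hmle s q hq)).trans hpq

theorem card_le_mul_of_colorable_of_indepSetFree [Finite V] (hk : G.Colorable k)
    (hn : G.IndepSetFree (n + 1)) : Nat.card V ≤ n * k := by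
  classical
  have := Fintype.ofFinite V
  obtain ⟨c⟩ := hk
  have hfiber (i : Fin k) : (Finset.univ.filter (c · = i)).card ≤ n := by
    by_contra! hlt
    obtain ⟨s, hs, hcard⟩ := Finset.exists_subset_card_eq (Nat.succ_le_of_lt hlt)
    refine hn s ⟨fun v hv w hw _ hvw => c.valid hvw ?_, hcard⟩
    rw [(Finset.mem_filter.1 (hs hv)).2, (Finset.mem_filter.1 (hs hw)).2]
  have := Finset.card_le_mul_card_image_of_maps_to (s := Finset.univ) (t := Finset.univ)
    (f := c) (fun _ _ => Finset.mem_univ _) n fun i _ => hfiber i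
  rwa [Finset.card_univ, Finset.card_univ, Fintype.card_fin, ← Nat.card_eq_fintype_card] at this

theorem IsModularQuotientMap.card_le_of_isPrimeGraph [Finite V] [Nonempty V]
    (hf : IsModularQuotientMap G H f) (hH : IsPrimeGraph H) (hG : G.IsVertexCritical k)
    (hL : HasLaminarTraces G) : Nat.card W ≤ 2 * k := by
  have : Finite W := Finite.of_surjective f hf.surjective
  by_cases hfree : H.IndepSetFree 3
  · obtain ⟨φ⟩ := hf.isIndContained
    exact card_le_mul_of_colorable_of_indepSetFree
      ((colorable_of_isVertexCritical hG).of_hom φ.toHom) hfree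
  · have h2 := hH.colorable_two (hL.of_isIndContained hf.isIndContained) hfree
    have hW : Nat.card W ≤ 2 := by
      by_contra! hW
      refine hf.not_colorable_two hG ?_ h2
      rw [ENat.card_eq_coe_natCard]
      exact_mod_cast hW
    have := pos_of_isVertexCritical hG
    omega

theorem card_le_of_isVertexCritical {V : Type u} [Finite V] {G : SimpleGraph V}
    (hG : G.IsVertexCritical k) (hL : HasLaminarTraces G) : Nat.card V ≤ 2 ^ k * k.factorial := by
  induction k using Nat.strong_induction_on generalizing V with
  | _ k ih =>
    rcases subsingleton_or_nontrivial V with hV | hV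
    · exact Finite.card_le_one_iff_subsingleton.2 hV |>.trans
        (Nat.one_le_iff_ne_zero.2 (by positivity))
    obtain ⟨W, H, f, hW, hH, hf⟩ := exists_isPrimeGraph_quotient G
    obtain ⟨k, rfl⟩ : ∃ j, k = j + 1 := Nat.exists_eq_succ_of_ne_zero
      (pos_of_isVertexCritical hG).ne'
    have hfiber (r : W) : Nat.card (f ⁻¹' {r}) ≤ 2 ^ k * k.factorial := by
      obtain ⟨j, hj, hcrit⟩ := (hf.isHomogeneousSet_fiber r).exists_isVertexCritical_induce hG
        (hf.fiber_ne_univ r)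
      refine (ih j hj hcrit (hL.of_isIndContained ⟨Embedding.induce _⟩)).trans ?_
      have := Nat.le_of_lt_succ hj
      gcongr
      norm_num
    have := Fintype.ofFinite V
    have : Fintype W := @Fintype.ofFinite W (Finite.of_surjective f hf.surjective)
    calc Nat.card V = ∑ r, Nat.card (f ⁻¹' {r}) := by
          rw [← Nat.card_sigma]
          exact Nat.card_congr (Equiv.sigmaFiberEquiv f).symm
      _ ≤ ∑ _r : W, 2 ^ k * k.factorial := Finset.sum_le_sum fun r _ => hfiber r
      _ = Nat.card W * (2 ^ k * k.factorial) := by simp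
      _ ≤ 2 * (k + 1) * (2 ^ k * k.factorial) := by
          gcongr
          exact hf.card_le_of_isPrimeGraph hH hG hL
      _ = 2 ^ (k + 1) * (k + 1).factorial := by
          rw [Nat.factorial_succ]
          ring

end Critical

theorem mainTheorem1_general (k : ℕ) :
    ∃ F : Set (Σ n : ℕ, SimpleGraph (Fin n)), F.Finite ∧
      ∀ (V : Type*) [Finite V] (G : SimpleGraph V),
        G.IsVertexCritical k →
        (SimpleGraph.pathGraph 5).IndFree G →
        SimpleGraph.bull.IndFree G →
        ∃ H ∈ F, Nonempty (G ≃g H.2) := by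
  refine ⟨⋃ n ∈ Set.Iic (2 ^ k * k.factorial), Set.range (Sigma.mk n),
    (Set.finite_Iic _).biUnion fun _ _ => Set.finite_range _, fun V _ G hG hP hB => ?_⟩
  have hcard : Nat.card V ≤ 2 ^ k * k.factorial :=
    card_le_of_isVertexCritical hG (hasLaminarTraces_of_indFree hP hB)
  exact ⟨⟨Nat.card V, G.map (Finite.equivFin V).toEmbedding⟩, Set.mem_biUnion hcard ⟨_, rfl⟩,
    ⟨Iso.map (Finite.equivFin V) G⟩⟩

/-- Up to isomorphism there are only finitely many finite `5`-vertex-critical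
`(P₅, bull)`-free graphs. -/
theorem mainTheorem1 :
    ∃ F : Set (Σ n : ℕ, SimpleGraph (Fin n)), F.Finite ∧
      ∀ (V : Type*) [Finite V] (G : SimpleGraph V),
        G.IsVertexCritical 5 →
        (SimpleGraph.pathGraph 5).IndFree G →
        SimpleGraph.bull.IndFree G →
        ∃ H ∈ F, Nonempty (G ≃g H.2) :=
  mainTheorem1_general 5
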